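/- Let $c_0,c_1\in\mathbb R^n$, $b_0,b_1\in\mathbb R^m$, $A_0,A_1\in\mathbb R^{m\times n}$, and for real $\varepsilon$ consider the linear program $$\max\ \langle c_0+\varepsilon c_1,x\rangle\quad\text{s.t.}\quad (A_0+\varepsilon A_1)x=b_0+\varepsilon b_1,\ x\ge 0,$$ with feasible set $\theta(\varepsilon)$, set of optimal solutions $\theta^*(\varepsilon)$ and optimal value $F^*(\varepsilon)=\sup_{x\in\theta(\varepsilon)}\langle c_0+\varepsilon c_1,x\rangle\in[-\infty,\infty]$ (with $\sup\emptyset=-\infty$). Let $J_0=\{j:\ x_j>0\text{ for some }x\in\theta(0)\}$, $$\Theta_1=\{(x^0,x^1)\in\mathbb R^n\times\mathbb R^n:\ x^0\in\theta(0),\ A_0x^1+A_1x^0=b_1,\ x^1_j\ge 0\ \ \forall j\notin J_0\},\qquad \theta_1=\{x^0:\ \exists x^1,\ (x^0,x^1)\in\Theta_1\}.$$ The limiting linear program is $\max\{\langle c_0,x\rangle:\ x\in\theta_1\}$; let $F_1^*=\sup_{x\in\theta_1}\langle c_0,x\rangle\in[-\infty,\infty]$ be its value and $\theta_1^*$ its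 set of optimal solutions. For a family of sets $S(\varepsilon)\subset\mathbb R^n$, $\limsup_{\varepsilon\downarrow0}S(\varepsilon)$ (resp. $\liminf_{\varepsilon\downarrow0}S(\varepsilon)$) is the set of $x$ such that every neighbourhood of $x$ meets $S(\varepsilon)$ for arbitrarily small $\varepsilon>0$ (resp. for all sufficiently small $\varepsilon>0$). A vector $x$ is called feasible limiting optimal if $x\in\liminf_{\varepsilon\downarrow 0}\theta(\varepsilon)$ and $\lim_{\varepsilon\downarrow 0}F^*(\varepsilon)=\langle c_0,x\rangle$. Assume that for all sufficiently small $\varepsilon>0$ the program is not unbounded, i.e. $F^*(\varepsilon)<+\infty$, and that * $(H_0^*)$ there are $\gamma_0>0$ and a bounded set $B\subset\mathbb R^n$ with $\theta^*(\varepsilon)\subset B$ for every $\varepsilon\in(0,\gamma_0]$; * $(H_2)$ $\operatorname{rank}(A_0+\varepsilon A_1)=m$ for all sufficiently small $\varepsilon>0$. Then $$\limsup_{\varepsilon\downarrow 0}\theta^*(\varepsilon)\subset\theta_1\qquad\text{and}\qquad \limsup_{\varepsilon\downarrow 0}F^*(\varepsilon)\le F_1^*.$$ If in addition $(H_1)$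 $\operatorname{rank}A_0=m$, and the extended Slater condition of order 1 (ES-1) holds, i.e. there is $(\hat x^0,\hat x^1)\in\Theta_1$ with $\hat x^1_j>0$ for all $j\notin J_0$ and $\hat x^0_j>0$ for all $j\in J_0$, then $$\limsup_{\varepsilon\downarrow 0}\theta^*(\varepsilon)\subset\theta_1^*,\qquad \lim_{\varepsilon\downarrow 0}F^*(\varepsilon)=F_1^*,$$ and every optimal solution of the limiting linear program is feasible limiting optimal. -/

import Mathlib

open Filter Topology

/-- Painlevé–Kuratowski outer limit of `S ε` as `ε ↓ 0`: the set of cluster points, i.e. of all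
`x = lim x_k` with `x_k ∈ S (ε_k)` for some sequence `ε_k ↓ 0`. -/
def outerLimit {E : Type*} [TopologicalSpace E] (S : ℝ → Set E) : Set E :=
  {x | ∀ U ∈ 𝓝 x, ∃ᶠ ε in 𝓝[>] (0 : ℝ), (S ε ∩ U).Nonempty}

/-- Painlevé–Kuratowski inner limit of `S ε` as `ε ↓ 0`: every neighbourhood of `x` meets `S ε`
for all sufficiently small `ε > 0`. -/
def innerLimit {E : Type*} [TopologicalSpace E] (S : ℝ → Set E) : Set E :=
  {x | ∀ U ∈ 𝓝 x, ∀ᶠ ε in 𝓝[>] (0 : ℝ), (S ε ∩ U).Nonempty}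

/-- The data of the family of linear programs
`max ⟨c₀ + ε c₁, x⟩` subject to `(A₀ + ε A₁) x = b₀ + ε b₁`, `x ≥ 0`. -/
structure PerturbedLP (m n : ℕ) where
  c₀ : Fin n → ℝ
  c₁ : Fin n → ℝ
  b₀ : Fin m → ℝ
  b₁ : Fin m → ℝ
  A₀ : Matrix (Fin m) (Fin n) ℝ
  A₁ : Matrix (Fin m) (Fin n) ℝ

namespace PerturbedLP

variable {m n : ℕ} (P : PerturbedLP m n)

/-- The feasible set `θ(ε)`. -/
def feasible (ε : ℝ) : Set (Fin n → ℝ) :=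
  {x | (P.A₀ + ε • P.A₁).mulVec x = P.b₀ + ε • P.b₁ ∧ ∀ j, 0 ≤ x j}

/-- The objective `⟨c₀ + ε c₁, x⟩`. -/
def objective (ε : ℝ) (x : Fin n → ℝ) : ℝ :=
  (P.c₀ + ε • P.c₁) ⬝ᵥ x

/-- The set `θ*(ε)` of optimal solutions. -/
def optimal (ε : ℝ) : Set (Fin n → ℝ) :=
  {x | x ∈ P.feasible ε ∧ ∀ y ∈ P.feasible ε, P.objective ε y ≤ P.objective ε x}

/-- The optimal value `F*(ε)`, with value `⊥` for an infeasible and `⊤` for an unbounded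
program. -/
noncomputable def value (ε : ℝ) : EReal :=
  ⨆ x ∈ P.feasible ε, (P.objective ε x : EReal)

/-- The index set `J₀`. -/
def J₀ : Set (Fin n) :=
  {j | ∃ x ∈ P.feasible 0, 0 < x j}

/-- The set `Θ₁` of pairs `(x⁰, x¹)`. -/
def bigTheta₁ : Set ((Fin n → ℝ) × (Fin n → ℝ)) :=
  {p | p.1 ∈ P.feasible 0 ∧ P.A₀.mulVec p.2 + P.A₁.mulVec p.1 = P.b₁ ∧
    ∀ j, j ∉ P.J₀ → 0 ≤ p.2 j}

/-- The feasible set `θ₁` of the limiting program. -/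
def theta₁ : Set (Fin n → ℝ) :=
  {x0 | ∃ x1, (x0, x1) ∈ P.bigTheta₁}

/-- The optimal value `F₁*` of the limiting program `max {⟨c₀, x⟩ : x ∈ θ₁}`. -/
noncomputable def value₁ : EReal :=
  ⨆ x ∈ P.theta₁, ((P.c₀ ⬝ᵥ x : ℝ) : EReal)

/-- The set `θ₁*` of optimal solutions of the limiting program. -/
def optimal₁ : Set (Fin n → ℝ) :=
  {x | x ∈ P.theta₁ ∧ ∀ y ∈ P.theta₁, P.c₀ ⬝ᵥ y ≤ P.c₀ ⬝ᵥ x}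

/-- Assumption (H₀*): the optimal sets are uniformly bounded for small `ε > 0`. -/
def H₀star : Prop :=
  ∃ γ₀ : ℝ, 0 < γ₀ ∧ ∃ B : Set (Fin n → ℝ), Bornology.IsBounded B ∧
    ∀ ε ∈ Set.Ioc 0 γ₀, P.optimal ε ⊆ B

/-- Assumption (H₁): `A₀` has rank `m`. -/
def H₁ : Prop := P.A₀.rank = m

/-- Assumption (H₂): `A₀ + ε A₁` has rank `m` for all sufficiently small `ε > 0`. -/
def H₂ : Prop := ∀ᶠ ε in 𝓝[>] (0 : ℝ), (P.A₀ + ε • P.A₁).rank = m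

/-- The extended Slater condition of order 1. -/
def ES1 : Prop :=
  ∃ x0 x1 : Fin n → ℝ, (x0, x1) ∈ P.bigTheta₁ ∧
    (∀ j, j ∉ P.J₀ → 0 < x1 j) ∧ (∀ j, j ∈ P.J₀ → 0 < x0 j)

/-- `x` is feasible limiting optimal for the perturbed program. -/
def FeasibleLimitingOptimal (x : Fin n → ℝ) : Prop :=
  x ∈ innerLimit P.feasible ∧
    Tendsto P.value (𝓝[>] (0 : ℝ)) (𝓝 ((P.c₀ ⬝ᵥ x : ℝ) : EReal))

end PerturbedLP

/-! The upper bounds rest on the closedness of finitely generated cones. It makes the set of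
objective values of a linear program closed, so a finite optimal value is attained. Moreover, if
`y ∈ θ(ε)` is close to `x ∈ θ(0)`, then `b₁ - A₁ y = A₀ ((y - x) / ε)` lies in the image under `A₀`
of the cone `{w | w j ≥ 0 for j ∉ J₀}`; as this image is closed, it contains `b₁ - A₁ x`, that is,
`x ∈ θ₁`. Compactness of the closure of `B` turns this into the bound on the optimal values.

For the lower bounds, under (H₁) a Slater pair `(x⁰, x¹)` is corrected at second order to a feasible
curve `x⁰ + ε x¹ - ε² z(ε)`, which is nonnegative for small `ε > 0` because of strict positivity.
Since Slater pairs are dense in `Θ₁` and inner limits are closed, `θ₁` is contained in the inner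
limit of `θ(ε)`. -/

section Cone

variable {𝕜 E F : Type*} [AddCommGroup E] [AddCommGroup F]

theorem exists_pos_relation_of_not_linearIndepOn [Ring 𝕜] [LinearOrder 𝕜] [IsOrderedRing 𝕜]
    [Module 𝕜 E] {ι : Type*} {v : ι → E} {s : Finset ι} (hs : ¬LinearIndepOn 𝕜 v s) :
    ∃ g : ι → 𝕜, ∑ i ∈ s, g i • v i = 0 ∧ ∃ i ∈ s, 0 < g i := by
  rw [linearIndepOn_finset_iff] at hs
  push Not at hs
  obtain ⟨g, hg, i, hi, hgi⟩ := hs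
  rcases hgi.lt_or_gt with hneg | hpos
  · exact ⟨-g, by simp [hg], i, hi, by simpa using hneg⟩
  · exact ⟨g, hg, i, hi, hpos⟩

theorem exists_mem_hull_erase_of_not_linearIndepOn [Field 𝕜] [LinearOrder 𝕜]
    [IsStrictOrderedRing 𝕜] [Module 𝕜 E] [DecidableEq E] {s : Finset E}
    (hs : ¬LinearIndepOn 𝕜 id (s : Set E)) {x : E}
    (hx : x ∈ PointedCone.hull 𝕜 (s : Set E)) :
    ∃ v ∈ s, x ∈ PointedCone.hull 𝕜 (s.erase v : Set E) := by
  obtain ⟨f, -, rfl⟩ := Submodule.mem_span_finset.1 hx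
  obtain ⟨g, hg, hpos⟩ := exists_pos_relation_of_not_linearIndepOn hs
  -- Move along the relation `g` until the first coefficient of `x` vanishes.
  obtain ⟨v, hv, hmin⟩ := Finset.exists_min_image (s.filter fun u => 0 < g u)
    (fun u => (f u : 𝕜) / g u) (by simpa [Finset.Nonempty] using hpos)
  obtain ⟨hvs, hgv⟩ := Finset.mem_filter.1 hv
  set r := (f v : 𝕜) / g v
  have hr : 0 ≤ r := div_nonneg (f v).2 hgv.le
  have hcoeff : ∀ u ∈ s, 0 ≤ (f u : 𝕜) - r * g u := fun u hu => by
    rcases lt_or_ge 0 (g u) with hgu | hgu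
    · exact sub_nonneg.2 ((le_div_iff₀ hgu).1 (hmin u (Finset.mem_filter.2 ⟨hu, hgu⟩)))
    · exact sub_nonneg.2 ((mul_nonpos_of_nonneg_of_nonpos hr hgu).trans (f u).2)
  have hsum : ∑ u ∈ s, f u • u = ∑ u ∈ s.erase v, ((f u : 𝕜) - r * g u) • u :=
    calc ∑ u ∈ s, f u • u = ∑ u ∈ s, (f u : 𝕜) • u - r • ∑ u ∈ s, g u • id u := by
          rw [hg, smul_zero, sub_zero]; rfl
      _ = ∑ u ∈ s, ((f u : 𝕜) - r * g u) • u := by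
          simp only [Finset.smul_sum, ← Finset.sum_sub_distrib, sub_smul, mul_smul, id]
      _ = ∑ u ∈ s.erase v, ((f u : 𝕜) - r * g u) • u :=
          (Finset.sum_erase s (by rw [div_mul_cancel₀ _ hgv.ne', sub_self, zero_smul])).symm
  exact ⟨v, hvs, hsum ▸ sum_mem fun u hu =>
    PointedCone.smul_mem _ (hcoeff u (Finset.mem_of_mem_erase hu)) (PointedCone.subset_hull hu)⟩

section Real

variable [Module ℝ E] [Module ℝ F] [TopologicalSpace F] [IsTopologicalAddGroup F]
  [ContinuousSMul ℝ F] [T2Space F]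

theorem isClosed_of_isSimplicial {C : PointedCone ℝ F} (hC : C.IsSimplicial) :
    IsClosed (C : Set F) := by
  obtain ⟨s, hs, hli, rfl⟩ := hC
  have := hs.fintype
  have hemb : IsClosedEmbedding (Fintype.linearCombination ℝ ((↑) : s → F)) :=
    LinearMap.isClosedEmbedding_of_injective
      (LinearMap.ker_eq_bot.2 hli.fintypeLinearCombination_injective)
  have himage : (PointedCone.hull ℝ s : Set F) =
      Fintype.linearCombination ℝ ((↑) : s → F) '' Set.Ici 0 := by
    ext x
    rw [SetLike.mem_coe, Submodule.mem_span_iff_of_fintype]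
    constructor
    · rintro ⟨f, rfl⟩
      exact ⟨fun i => f i, fun i => (f i).2, rfl⟩
    · rintro ⟨f, hf, rfl⟩
      exact ⟨fun i => ⟨f i, hf i⟩, rfl⟩
  rw [himage]
  exact hemb.isClosedMap _ isClosed_Ici

/-- Conic Carathéodory writes a finitely generated cone as a finite union of simplicial ones. -/
theorem isClosed_of_fg {C : PointedCone ℝ F} (hC : C.FG) : IsClosed (C : Set F) := by
  classical
  obtain ⟨s, rfl⟩ := hC
  induction s using Finset.strongInduction with
  | H s ih =>
    by_cases hs : LinearIndepOn ℝ id (s : Set F)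
    · exact isClosed_of_isSimplicial (.hull s.finite_toSet hs)
    · have hunion : (PointedCone.hull ℝ (s : Set F) : Set F) =
          ⋃ v ∈ s, (PointedCone.hull ℝ (s.erase v : Set F) : Set F) := by
        refine subset_antisymm (fun x hx => ?_) (Set.iUnion₂_subset fun v _ => ?_)
        · obtain ⟨v, hv, hxv⟩ := exists_mem_hull_erase_of_not_linearIndepOn hs hx
          exact Set.mem_biUnion hv hxv
        · exact Submodule.span_mono (Finset.coe_subset.2 (s.erase_subset v))
      rw [hunion]
      exact s.finite_toSet.isClosed_biUnion fun v hv => ih _ (Finset.erase_ssubset hv)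

theorem exists_isMaxOn_of_fg_of_bddAbove {C : PointedCone ℝ E} (hC : C.FG) (A : E →ₗ[ℝ] F)
    (f : E →ₗ[ℝ] ℝ) {b : F} (hne : {x ∈ C | A x = b}.Nonempty)
    (hbdd : BddAbove (f '' {x ∈ C | A x = b})) :
    ∃ x ∈ {x ∈ C | A x = b}, IsMaxOn f {x ∈ C | A x = b} x := by
  have hvalues : f '' {x ∈ C | A x = b} = {t | (b, t) ∈ C.map (A.prod f)} := by
    ext t
    simp [PointedCone.mem_map, and_assoc]
  have hclosed : IsClosed (f '' {x ∈ C | A x = b}) := by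
    rw [hvalues]
    exact (isClosed_of_fg (hC.map _)).preimage (by fun_prop)
  obtain ⟨x, hx, hsup⟩ := hclosed.csSup_mem (hne.image f) hbdd
  exact ⟨x, hx, fun y hy => hsup ▸ le_csSup hbdd (Set.mem_image_of_mem f hy)⟩

end Real

/-- The cone of vectors whose coordinates outside `J` are nonnegative: the orthant for `J = ∅`, and
the cone of first-order corrections in `Θ₁` for `J = J₀`. -/
def nonnegOff (𝕜 : Type*) {ι : Type*} [Ring 𝕜] [LinearOrder 𝕜] [IsOrderedRing 𝕜] (J : Set ι) :
    PointedCone 𝕜 (ι → 𝕜) where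
  carrier := {w | ∀ i ∉ J, 0 ≤ w i}
  zero_mem' _ _ := le_rfl
  add_mem' hv hw i hi := add_nonneg (hv i hi) (hw i hi)
  smul_mem' c _ hw i hi := mul_nonneg c.2 (hw i hi)

theorem mem_nonnegOff {ι : Type*} [Ring 𝕜] [LinearOrder 𝕜] [IsOrderedRing 𝕜] {J : Set ι}
    {w : ι → 𝕜} : w ∈ nonnegOff 𝕜 J ↔ ∀ i ∉ J, 0 ≤ w i :=
  Iff.rfl

theorem nonnegOff_fg {ι : Type*} [Finite ι] [Ring 𝕜] [LinearOrder 𝕜] [IsOrderedRing 𝕜]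
    (J : Set ι) : (nonnegOff 𝕜 J).FG := by
  classical
  have := Fintype.ofFinite ι
  let e : ι → ι → 𝕜 := fun i => Pi.single i 1
  refine Submodule.fg_def.2 ⟨Set.range e ∪ (fun i => -e i) '' J, Set.toFinite _,
    le_antisymm (Submodule.span_le.2 ?_) fun w hw => ?_⟩
  · rintro _ (⟨i, rfl⟩ | ⟨i, hi, rfl⟩) k hk
    · exact (Pi.single_nonneg.2 zero_le_one : 0 ≤ e i) k
    · simp [e, ne_of_mem_of_not_mem hi hk |>.symm]
  · have hsum : w = ∑ i, w i • e i := by simp [e, ← Pi.single_smul, Finset.univ_sum_single]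
    rw [hsum]
    refine sum_mem fun i _ => ?_
    rcases le_or_gt 0 (w i) with hi | hi
    · exact PointedCone.smul_mem _ hi (PointedCone.subset_hull (.inl ⟨i, rfl⟩))
    · have hiJ : i ∈ J := not_imp_comm.1 (hw i) hi.not_ge
      rw [← neg_smul_neg]
      exact PointedCone.smul_mem _ (neg_nonneg.2 hi.le)
        (PointedCone.subset_hull (.inr ⟨i, hiJ, rfl⟩))

end Cone

section RightInverse

variable {𝕜 m n : Type*} [Field 𝕜] [Fintype m] [Fintype n] [DecidableEq m]

theorem exists_mul_eq_one_of_rank_eq_card {A : Matrix m n 𝕜} (hA : A.rank = Fintype.card m) :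
    ∃ R : Matrix n m 𝕜, A * R = 1 := by
  refine Matrix.mulVec_surjective_iff_exists_right_inverse.1 ?_
  rw [← Matrix.coe_mulVecLin, ← LinearMap.range_eq_top]
  exact Submodule.eq_top_of_finrank_eq (hA.trans (Module.finrank_fintype_fun_eq_card 𝕜).symm)

theorem exists_continuousAt_mul_eq_one [TopologicalSpace 𝕜] [IsTopologicalDivisionRing 𝕜]
    [T1Space 𝕜] {X : Type*} [TopologicalSpace X] {A : X → Matrix m n 𝕜} {a : X}
    (hA : ContinuousAt A a) (hrank : (A a).rank = Fintype.card m) :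
    ∃ R : X → Matrix n m 𝕜, ContinuousAt R a ∧ ∀ᶠ x in 𝓝 a, A x * R x = 1 := by
  obtain ⟨R₀, hR₀⟩ := exists_mul_eq_one_of_rank_eq_card hrank
  have hM : ContinuousAt (fun x => A x * R₀) a :=
    (continuous_id.matrix_mul continuous_const).continuousAt.comp hA
  have hdet : (A a * R₀).det ≠ 0 := by simp [hR₀]
  have hinv : ContinuousAt (fun x => (A x * R₀)⁻¹) a :=
    (continuousAt_matrix_inv _ (by
      simpa only [Ring.inverse_eq_inv'] using continuousAt_inv₀ hdet)).comp hM
  refine ⟨fun x => R₀ * (A x * R₀)⁻¹,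
    (continuous_const.matrix_mul continuous_id).continuousAt.comp hinv, ?_⟩
  have hdet_ne : ∀ᶠ x in 𝓝 a, (A x * R₀).det ≠ 0 :=
    (continuous_id.matrix_det.continuousAt.comp hM).eventually_ne hdet
  filter_upwards [hdet_ne] with x hx
  rw [← Matrix.mul_assoc, Matrix.mul_nonsing_inv _ hx.isUnit]

end RightInverse

section SetLimits

variable {E : Type*} [TopologicalSpace E] {S T : ℝ → Set E} {x : E}

theorem mem_outerLimit_iff_frequently :
    x ∈ outerLimit S ↔ ∃ᶠ p in 𝓝[>] (0 : ℝ) ×ˢ 𝓝 x, p.2 ∈ S p.1 := by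
  rw [((𝓝[>] (0 : ℝ)).basis_sets.prod (𝓝 x).basis_sets).frequently_iff]
  constructor
  · rintro hx ⟨V, U⟩ ⟨hV, hU⟩
    obtain ⟨ε, ⟨y, hyS, hyU⟩, hε⟩ := ((hx U hU).and_eventually hV).exists
    exact ⟨(ε, y), ⟨hε, hyU⟩, hyS⟩
  · refine fun hx U hU => frequently_iff.2 fun {V} hV => ?_
    obtain ⟨⟨ε, y⟩, ⟨hε, hyU⟩, hyS⟩ := hx (i := (V, U)) ⟨hV, hU⟩
    exact ⟨ε, hε, y, hyS, hyU⟩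

theorem outerLimit_mono_of_eventually (h : ∀ᶠ ε in 𝓝[>] (0 : ℝ), S ε ⊆ T ε) :
    outerLimit S ⊆ outerLimit T := fun _ hx U hU =>
  ((hx U hU).and_eventually h).mono fun _ hε => hε.1.mono (Set.inter_subset_inter_left U hε.2)

theorem outerLimit_subset_of_isClosed_graph (hS : IsClosed {p : ℝ × E | p.2 ∈ S p.1}) :
    outerLimit S ⊆ S 0 := fun x hx =>
  hS.mem_of_frequently_of_tendsto (mem_outerLimit_iff_frequently.1 hx)
    (show Tendsto id (𝓝[>] (0 : ℝ) ×ˢ 𝓝 x) (𝓝 (0, x)) from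
      nhds_prod_eq (x := (0 : ℝ)) (y := x) ▸ prod_mono_left _ nhdsWithin_le_nhds)

theorem outerLimit_inter_nonempty_of_isCompact {K : Set E} (hK : IsCompact K)
    (hS : ∃ᶠ ε in 𝓝[>] (0 : ℝ), (S ε ∩ K).Nonempty) : (outerLimit S ∩ K).Nonempty := by
  contrapose! hS
  have hlocal : ∀ z ∈ K, ∃ U ∈ 𝓝[K] z, ∀ᶠ ε in 𝓝[>] (0 : ℝ), S ε ∩ U = ∅ := fun z hz => by
    have hz' : z ∉ outerLimit S := fun h => Set.notMem_empty z (hS ▸ ⟨h, hz⟩)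
    simp only [outerLimit, Set.mem_ofPred_eq, not_forall, not_frequently,
      Set.not_nonempty_iff_eq_empty] at hz'
    obtain ⟨U, hU, hSU⟩ := hz'
    exact ⟨U, mem_nhdsWithin_of_mem_nhds hU, hSU⟩
  refine hK.induction_on (p := fun U => ∀ᶠ ε in 𝓝[>] (0 : ℝ), S ε ∩ U = ∅) (by simp)
    (fun U V hUV hV => ?_) (fun U V hU hV => ?_) hlocal
  · exact hV.mono fun ε hε => Set.subset_eq_empty (Set.inter_subset_inter_right _ hUV) hε
  · filter_upwards [hU, hV] with ε hεU hεV
    rw [Set.inter_union_distrib_left, hεU, hεV, Set.union_empty]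

theorem mem_innerLimit_of_tendsto {y : ℝ → E} (hy : Tendsto y (𝓝[>] 0) (𝓝 x))
    (hS : ∀ᶠ ε in 𝓝[>] (0 : ℝ), y ε ∈ S ε) : x ∈ innerLimit S := fun _ hU =>
  (hS.and (hy hU)).mono fun ε hε => ⟨y ε, hε⟩

theorem isClosed_innerLimit (S : ℝ → Set E) : IsClosed (innerLimit S) := by
  refine isClosed_of_closure_subset fun x hx U hU => ?_
  obtain ⟨z, hzU, hz⟩ := mem_closure_iff_nhds.1 hx _ (interior_mem_nhds.2 hU)
  exact hz U (mem_interior_iff_mem_nhds.1 hzU)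

end SetLimits

theorem eventually_nonneg_add_smul {ι : Type*} [Finite ι] {x v : ι → ℝ} {u : ℝ → ι → ℝ}
    (hx : 0 ≤ x) (hxv : ∀ i, 0 < x i ∨ 0 < v i) (hu : Tendsto u (𝓝[>] 0) (𝓝 v)) :
    ∀ᶠ ε in 𝓝[>] (0 : ℝ), 0 ≤ x + ε • u ε := by
  refine eventually_all.2 fun i => ?_
  have hui : Tendsto (fun ε => u ε i) (𝓝[>] 0) (𝓝 (v i)) := tendsto_pi_nhds.1 hu i
  rcases hxv i with hi | hi
  · have hlim : Tendsto (fun ε => x i + ε * u ε i) (𝓝[>] 0) (𝓝 (x i + 0 * v i)) :=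
      tendsto_const_nhds.add ((tendsto_id.mono_right nhdsWithin_le_nhds).mul hui)
    exact (hlim.eventually_const_lt (by simpa using hi)).mono fun _ hε => hε.le
  · filter_upwards [hui.eventually_const_lt hi, self_mem_nhdsWithin] with ε hε hpos
    exact add_nonneg (hx i) (mul_nonneg (le_of_lt hpos) hε.le)

namespace PerturbedLP

variable {m n : ℕ} (P : PerturbedLP m n)

/-- The pairs witnessing the extended Slater condition of order 1. They are dense in `Θ₁` as soon
as one exists. -/
def slaterPairs : Set ((Fin n → ℝ) × (Fin n → ℝ)) :=
  {p ∈ P.bigTheta₁ | (∀ j, j ∉ P.J₀ → 0 < p.2 j) ∧ ∀ j, j ∈ P.J₀ → 0 < p.1 j}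

theorem objective_zero (x : Fin n → ℝ) : P.objective 0 x = P.c₀ ⬝ᵥ x := by
  simp [objective]

theorem continuous_objective : Continuous fun p : ℝ × (Fin n → ℝ) => P.objective p.1 p.2 :=
  Continuous.dotProduct (by fun_prop) continuous_snd

theorem outerLimit_superlevel_subset (r : ℝ) :
    outerLimit (fun ε => {x | r ≤ P.objective ε x}) ⊆ {x | r ≤ P.c₀ ⬝ᵥ x} := by
  simpa only [objective_zero] using
    outerLimit_subset_of_isClosed_graph (S := fun ε => {x | r ≤ P.objective ε x})
      (isClosed_le continuous_const P.continuous_objective)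

theorem isClosed_feasible_graph : IsClosed {p : ℝ × (Fin n → ℝ) | p.2 ∈ P.feasible p.1} := by
  have hnonneg : IsClosed {p : ℝ × (Fin n → ℝ) | 0 ≤ p.2} :=
    isClosed_le continuous_const continuous_snd
  exact (isClosed_eq (Continuous.matrix_mulVec (by fun_prop) continuous_snd)
    (by fun_prop)).inter hnonneg

variable {P}

theorem mem_feasible_iff {ε : ℝ} {x : Fin n → ℝ} :
    x ∈ P.feasible ε ↔
      P.A₀.mulVec x + ε • P.A₁.mulVec x = P.b₀ + ε • P.b₁ ∧ ∀ j, 0 ≤ x j := by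
  rw [← Matrix.smul_mulVec, ← Matrix.add_mulVec]
  rfl

theorem mem_feasible_zero_iff {x : Fin n → ℝ} :
    x ∈ P.feasible 0 ↔ P.A₀.mulVec x = P.b₀ ∧ ∀ j, 0 ≤ x j := by
  simp only [mem_feasible_iff, zero_smul, add_zero]

theorem coe_objective_le_value {ε : ℝ} {x : Fin n → ℝ} (hx : x ∈ P.feasible ε) :
    (P.objective ε x : EReal) ≤ P.value ε :=
  le_iSup₂_of_le x hx le_rfl

theorem value_eq_of_mem_optimal {ε : ℝ} {x : Fin n → ℝ} (hx : x ∈ P.optimal ε) :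
    P.value ε = P.objective ε x :=
  le_antisymm (iSup₂_le fun y hy => EReal.coe_le_coe (hx.2 y hy)) (coe_objective_le_value hx.1)

theorem value₁_eq_of_mem_optimal₁ {x : Fin n → ℝ} (hx : x ∈ P.optimal₁) :
    P.value₁ = ((P.c₀ ⬝ᵥ x : ℝ) : EReal) :=
  le_antisymm (iSup₂_le fun y hy => EReal.coe_le_coe (hx.2 y hy)) (le_iSup₂_of_le x hx.1 le_rfl)

theorem optimal_nonempty {ε : ℝ} (hne : (P.feasible ε).Nonempty) (hfin : P.value ε < ⊤) :
    (P.optimal ε).Nonempty := by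
  have hfeas : P.feasible ε = {x ∈ nonnegOff ℝ (∅ : Set (Fin n)) |
      (P.A₀ + ε • P.A₁).mulVecLin x = P.b₀ + ε • P.b₁} := by
    ext x
    simp [mem_feasible_iff, mem_nonnegOff, and_comm]
  have hbdd : BddAbove (P.objective ε '' P.feasible ε) := by
    obtain ⟨r, hr, -⟩ := EReal.lt_iff_exists_real_btwn.1 hfin
    exact ⟨r, Set.forall_mem_image.2 fun x hx =>
      EReal.coe_le_coe_iff.1 ((coe_objective_le_value hx).trans hr.le)⟩
  rw [hfeas] at hne hbdd
  obtain ⟨x, hx, hmax⟩ := exists_isMaxOn_of_fg_of_bddAbove (nonnegOff_fg ∅)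
    (P.A₀ + ε • P.A₁).mulVecLin (dotProductBilin ℝ ℝ (P.c₀ + ε • P.c₁)) hne hbdd
  rw [← hfeas] at hx hmax
  exact ⟨x, hx, hmax⟩

theorem sub_mulVec_mem_map_nonnegOff {ε : ℝ} (hε : 0 < ε) {x y : Fin n → ℝ}
    (hx : x ∈ P.feasible 0) (hy : y ∈ P.feasible ε) :
    P.b₁ - P.A₁.mulVec y ∈ (nonnegOff ℝ P.J₀).map P.A₀.mulVecLin := by
  obtain ⟨hAy, hy0⟩ := mem_feasible_iff.1 hy
  refine PointedCone.mem_map.2 ⟨ε⁻¹ • (y - x), fun j hj => ?_, ?_⟩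
  · have hxj : x j ≤ 0 := not_lt.1 fun h => hj ⟨x, hx, h⟩
    exact mul_nonneg (inv_nonneg.2 hε.le) (sub_nonneg.2 (hxj.trans (hy0 j)))
  · rw [map_smul, inv_smul_eq_iff₀ hε.ne', map_sub, Matrix.mulVecLin_apply,
      Matrix.mulVecLin_apply, (mem_feasible_zero_iff.1 hx).1, smul_sub, sub_eq_sub_iff_add_eq_add,
      hAy, add_comm]

theorem outerLimit_feasible_subset_theta₁ : outerLimit P.feasible ⊆ P.theta₁ := by
  intro x hx
  have hx₀ : x ∈ P.feasible 0 := outerLimit_subset_of_isClosed_graph P.isClosed_feasible_graph hx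
  have hcont : Tendsto (fun p : ℝ × (Fin n → ℝ) => P.b₁ - P.A₁.mulVec p.2)
      (𝓝[>] 0 ×ˢ 𝓝 x) (𝓝 (P.b₁ - P.A₁.mulVec x)) :=
    (continuous_const.sub (Continuous.matrix_mulVec continuous_const continuous_id)).continuousAt
      |>.tendsto.comp tendsto_snd
  have hpos : ∀ᶠ p in 𝓝[>] (0 : ℝ) ×ˢ 𝓝 x, 0 < p.1 :=
    tendsto_fst.eventually self_mem_nhdsWithin
  have hfreq : ∃ᶠ p in 𝓝[>] (0 : ℝ) ×ˢ 𝓝 x,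
      P.b₁ - P.A₁.mulVec p.2 ∈ (nonnegOff ℝ P.J₀).map P.A₀.mulVecLin :=
    ((mem_outerLimit_iff_frequently.1 hx).and_eventually hpos).mono fun p hp =>
      sub_mulVec_mem_map_nonnegOff hp.2 hx₀ hp.1
  obtain ⟨x₁, hx₁, hAx₁⟩ := PointedCone.mem_map.1 <|
    (isClosed_of_fg ((nonnegOff_fg P.J₀).map _)).mem_of_frequently_of_tendsto hfreq hcont
  exact ⟨x₁, hx₀, eq_sub_iff_add_eq.1 hAx₁, hx₁⟩

theorem outerLimit_optimal_subset_theta₁ : outerLimit P.optimal ⊆ P.theta₁ :=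
  (outerLimit_mono_of_eventually (.of_forall fun _ _ hx => hx.1)).trans
    outerLimit_feasible_subset_theta₁

theorem exists_mem_optimal_le_objective_of_lt_value {ε r : ℝ} (hr : (r : EReal) < P.value ε)
    (hfin : P.value ε < ⊤) : ∃ x ∈ P.optimal ε, r ≤ P.objective ε x := by
  obtain ⟨y, hy, -⟩ : ∃ y, ∃ _ : y ∈ P.feasible ε, (r : EReal) < P.objective ε y := by
    simpa only [value, lt_iSup_iff] using hr
  obtain ⟨x, hx⟩ := optimal_nonempty ⟨y, hy⟩ hfin
  exact ⟨x, hx, EReal.coe_le_coe_iff.1 (value_eq_of_mem_optimal hx ▸ hr.le)⟩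

theorem limsup_value_le_value₁ (hbdd : ∀ᶠ ε in 𝓝[>] (0 : ℝ), P.value ε < ⊤) (hH₀ : P.H₀star) :
    limsup P.value (𝓝[>] (0 : ℝ)) ≤ P.value₁ := by
  obtain ⟨γ₀, hγ₀, B, hB, hoptB⟩ := hH₀
  refine EReal.ge_of_forall_gt_iff_ge.1 fun r hr => ?_
  let S : ℝ → Set (Fin n → ℝ) := fun ε => P.optimal ε ∩ {x | r ≤ P.objective ε x}
  have hfreq : ∃ᶠ ε in 𝓝[>] (0 : ℝ), (S ε ∩ closure B).Nonempty := by
    refine ((frequently_lt_of_lt_limsup (by isBoundedDefault) hr).and_eventually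
      (hbdd.and (Ioc_mem_nhdsGT hγ₀))).mono ?_
    rintro ε ⟨hlt, hfin, hε⟩
    obtain ⟨x, hx, hrx⟩ := exists_mem_optimal_le_objective_of_lt_value hlt hfin
    exact ⟨x, ⟨hx, hrx⟩, subset_closure (hoptB ε hε hx)⟩
  obtain ⟨z, hz, -⟩ := outerLimit_inter_nonempty_of_isCompact hB.isCompact_closure hfreq
  have hzθ : z ∈ P.theta₁ := outerLimit_optimal_subset_theta₁
    (outerLimit_mono_of_eventually (.of_forall fun _ => Set.inter_subset_left) hz)
  have hrz : r ≤ P.c₀ ⬝ᵥ z := P.outerLimit_superlevel_subset r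
    (outerLimit_mono_of_eventually (.of_forall fun _ => Set.inter_subset_right) hz)
  exact (EReal.coe_le_coe hrz).trans (le_iSup₂_of_le z hzθ le_rfl)

theorem convex_bigTheta₁ : Convex ℝ P.bigTheta₁ := by
  rintro p ⟨hp₀, hp, hp₁⟩ q ⟨hq₀, hq, hq₁⟩ a b ha hb hab
  obtain ⟨hAp, hp0⟩ := mem_feasible_zero_iff.1 hp₀
  obtain ⟨hAq, hq0⟩ := mem_feasible_zero_iff.1 hq₀
  refine ⟨mem_feasible_zero_iff.2 ⟨?_, fun j => ?_⟩, ?_, fun j hj => ?_⟩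
  · simp only [Prod.fst_add, Prod.smul_fst, Matrix.mulVec_add, Matrix.mulVec_smul, hAp, hAq,
      Convex.combo_self hab]
  · exact add_nonneg (mul_nonneg ha (hp0 j)) (mul_nonneg hb (hq0 j))
  · simp only [Prod.fst_add, Prod.smul_fst, Prod.snd_add, Prod.smul_snd, Matrix.mulVec_add,
      Matrix.mulVec_smul]
    rw [add_add_add_comm, ← smul_add, ← smul_add, hp, hq, Convex.combo_self hab]
  · exact add_nonneg (mul_nonneg ha (hp₁ j hj)) (mul_nonneg hb (hq₁ j hj))

theorem openSegment_subset_slaterPairs {p q : (Fin n → ℝ) × (Fin n → ℝ)} (hp : p ∈ P.bigTheta₁)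
    (hq : q ∈ P.slaterPairs) : openSegment ℝ p q ⊆ P.slaterPairs := by
  rintro _ ⟨a, b, ha, hb, hab, rfl⟩
  refine ⟨convex_bigTheta₁ hp hq.1 ha.le hb.le hab, fun j hj => ?_, fun j hj => ?_⟩
  · exact add_pos_of_nonneg_of_pos (mul_nonneg ha.le (hp.2.2 j hj)) (mul_pos hb (hq.2.1 j hj))
  · exact add_pos_of_nonneg_of_pos (mul_nonneg ha.le (hp.1.2 j)) (mul_pos hb (hq.2.2 j hj))

theorem bigTheta₁_subset_closure_slaterPairs (h : P.slaterPairs.Nonempty) :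
    P.bigTheta₁ ⊆ closure P.slaterPairs := by
  obtain ⟨q, hq⟩ := h
  exact fun p hp => closure_mono (openSegment_subset_slaterPairs hp hq)
    (segment_subset_closure_openSegment (left_mem_segment ℝ p q))

/-- `x₀ + ε • x₁` solves the perturbed system up to `ε ^ 2 • A₁ x₁`, which `ε ^ 2 • z` cancels. -/
theorem mulVec_add_smul_sub_smul_eq {ε : ℝ} {p : (Fin n → ℝ) × (Fin n → ℝ)} {z : Fin n → ℝ}
    (hp : p ∈ P.bigTheta₁) (hz : (P.A₀ + ε • P.A₁).mulVec z = P.A₁.mulVec p.2) :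
    (P.A₀ + ε • P.A₁).mulVec (p.1 + ε • (p.2 - ε • z)) = P.b₀ + ε • P.b₁ :=
  calc (P.A₀ + ε • P.A₁).mulVec (p.1 + ε • (p.2 - ε • z))
      = (P.A₀ + ε • P.A₁).mulVec p.1 +
          ε • ((P.A₀ + ε • P.A₁).mulVec p.2 - ε • P.A₁.mulVec p.2) := by
        simp only [Matrix.mulVec_add, Matrix.mulVec_sub, Matrix.mulVec_smul, hz]
    _ = P.A₀.mulVec p.1 + ε • (P.A₀.mulVec p.2 + P.A₁.mulVec p.1) := by
        simp only [Matrix.add_mulVec, Matrix.smul_mulVec]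
        module
    _ = P.b₀ + ε • P.b₁ := by rw [(mem_feasible_zero_iff.1 hp.1).1, hp.2.1]

theorem fst_mem_innerLimit_feasible_of_mem_slaterPairs (h : P.H₁)
    {p : (Fin n → ℝ) × (Fin n → ℝ)} (hp : p ∈ P.slaterPairs) : p.1 ∈ innerLimit P.feasible := by
  obtain ⟨hpΘ, hpos₁, hpos₀⟩ := hp
  have hA : Continuous fun ε : ℝ => P.A₀ + ε • P.A₁ := by fun_prop
  have hrank : (P.A₀ + (0 : ℝ) • P.A₁).rank = Fintype.card (Fin m) := by
    rwa [zero_smul, add_zero, Fintype.card_fin]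
  obtain ⟨R, hR, hAR⟩ := exists_continuousAt_mul_eq_one hA.continuousAt hrank
  let z : ℝ → Fin n → ℝ := fun ε => (R ε).mulVec (P.A₁.mulVec p.2)
  have hz : ContinuousAt z 0 :=
    (Continuous.matrix_mulVec continuous_id continuous_const).continuousAt.comp hR
  have hε : Tendsto id (𝓝[>] (0 : ℝ)) (𝓝 0) := nhdsWithin_le_nhds
  have hu : Tendsto (fun ε => p.2 - ε • z ε) (𝓝[>] 0) (𝓝 p.2) := by
    simpa using tendsto_const_nhds.sub (hε.smul (hz.tendsto.mono_left nhdsWithin_le_nhds))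
  have hy : Tendsto (fun ε => p.1 + ε • (p.2 - ε • z ε)) (𝓝[>] 0) (𝓝 p.1) := by
    simpa using tendsto_const_nhds.add (hε.smul hu)
  have hnonneg : ∀ᶠ ε in 𝓝[>] (0 : ℝ), 0 ≤ p.1 + ε • (p.2 - ε • z ε) :=
    eventually_nonneg_add_smul hpΘ.1.2
      (fun j => (em (j ∈ P.J₀)).imp (hpos₀ j) (hpos₁ j)) hu
  refine mem_innerLimit_of_tendsto hy ?_
  filter_upwards [hnonneg, hAR.filter_mono nhdsWithin_le_nhds] with ε hyε hARε
  have hAz : (P.A₀ + ε • P.A₁).mulVec (z ε) = P.A₁.mulVec p.2 := by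
    rw [Matrix.mulVec_mulVec, hARε, Matrix.one_mulVec]
  exact ⟨mulVec_add_smul_sub_smul_eq hpΘ hAz, hyε⟩

theorem theta₁_subset_innerLimit_feasible (h : P.H₁) (hES : P.ES1) :
    P.theta₁ ⊆ innerLimit P.feasible := by
  obtain ⟨s₀, s₁, hs, hs₁, hs₀⟩ := hES
  rintro x ⟨x₁, hx⟩
  have hcl : (x, x₁) ∈ closure P.slaterPairs :=
    bigTheta₁_subset_closure_slaterPairs ⟨(s₀, s₁), hs, hs₁, hs₀⟩ hx
  exact closure_minimal (fun _ => fst_mem_innerLimit_feasible_of_mem_slaterPairs h)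
    ((isClosed_innerLimit P.feasible).preimage continuous_fst) hcl

theorem eventually_exists_lt_objective {x : Fin n → ℝ} (hx : x ∈ innerLimit P.feasible) {r : ℝ}
    (hr : r < P.c₀ ⬝ᵥ x) : ∀ᶠ ε in 𝓝[>] (0 : ℝ), ∃ y ∈ P.feasible ε, r < P.objective ε y := by
  have hnear : ∀ᶠ p in 𝓝 (0 : ℝ) ×ˢ 𝓝 x, r < P.objective p.1 p.2 := by
    rw [← nhds_prod_eq]
    exact P.continuous_objective.continuousAt.eventually_const_lt
      (hr.trans_eq (P.objective_zero x).symm)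
  obtain ⟨V, hV, U, hU, hVU⟩ := mem_prod_iff.1 hnear
  filter_upwards [hx U hU, nhdsWithin_le_nhds hV] with ε ⟨y, hy, hyU⟩ hε
  exact ⟨y, hy, hVU (Set.mk_mem_prod hε hyU)⟩

theorem coe_dotProduct_le_liminf_value {x : Fin n → ℝ} (hx : x ∈ innerLimit P.feasible) :
    ((P.c₀ ⬝ᵥ x : ℝ) : EReal) ≤ liminf P.value (𝓝[>] (0 : ℝ)) := by
  refine EReal.ge_of_forall_gt_iff_ge.1 fun r hr => le_liminf_of_le (by isBoundedDefault) ?_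
  filter_upwards [eventually_exists_lt_objective hx (EReal.coe_lt_coe_iff.1 hr)]
    with ε ⟨y, hy, hlt⟩
  exact (EReal.coe_le_coe hlt.le).trans (coe_objective_le_value hy)

theorem dotProduct_le_of_mem_outerLimit_optimal {x y : Fin n → ℝ} (hx : x ∈ outerLimit P.optimal)
    (hy : y ∈ innerLimit P.feasible) : P.c₀ ⬝ᵥ y ≤ P.c₀ ⬝ᵥ x := by
  refine le_of_forall_lt_imp_le_of_dense fun r hr => P.outerLimit_superlevel_subset r ?_
  refine outerLimit_mono_of_eventually ?_ hx
  filter_upwards [eventually_exists_lt_objective hy hr] with ε ⟨w, hw, hlt⟩ z hz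
  exact hlt.le.trans (hz.2 w hw)

end PerturbedLP

open PerturbedLP in
theorem mainTheorem1_general {m n : ℕ} (P : PerturbedLP m n)
    (hbdd : ∀ᶠ ε in 𝓝[>] (0 : ℝ), P.value ε < ⊤) (hH₀ : P.H₀star) :
    outerLimit P.optimal ⊆ P.theta₁ ∧
    limsup P.value (𝓝[>] (0 : ℝ)) ≤ P.value₁ ∧
    (P.H₁ → P.ES1 →
      outerLimit P.optimal ⊆ P.optimal₁ ∧
      Tendsto P.value (𝓝[>] (0 : ℝ)) (𝓝 P.value₁) ∧
      ∀ x ∈ P.optimal₁, P.FeasibleLimitingOptimal x) := by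
  have hlimsup := limsup_value_le_value₁ hbdd hH₀
  refine ⟨outerLimit_optimal_subset_theta₁, hlimsup, fun hH₁ hES => ?_⟩
  have hinner : P.theta₁ ⊆ innerLimit P.feasible :=
    theta₁_subset_innerLimit_feasible hH₁ hES
  have hliminf : P.value₁ ≤ liminf P.value (𝓝[>] (0 : ℝ)) :=
    iSup₂_le fun x hx => coe_dotProduct_le_liminf_value (hinner hx)
  have hlim : Tendsto P.value (𝓝[>] (0 : ℝ)) (𝓝 P.value₁) :=
    tendsto_of_le_liminf_of_limsup_le hliminf hlimsup
  refine ⟨fun x hx => ⟨outerLimit_optimal_subset_theta₁ hx, fun y hy => ?_⟩, hlim,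
    fun x hx => ⟨hinner hx.1, ?_⟩⟩
  · exact dotProduct_le_of_mem_outerLimit_optimal hx (hinner hy)
  · rwa [← value₁_eq_of_mem_optimal₁ hx]

theorem mainTheorem1 {m n : ℕ} (P : PerturbedLP m n)
    (hbdd : ∀ᶠ ε in 𝓝[>] (0 : ℝ), P.value ε < ⊤)
    (hH₀ : P.H₀star) (hH₂ : P.H₂) :
    outerLimit P.optimal ⊆ P.theta₁ ∧
    limsup P.value (𝓝[>] (0 : ℝ)) ≤ P.value₁ ∧
    (P.H₁ → P.ES1 →
      outerLimit P.optimal ⊆ P.optimal₁ ∧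
      Tendsto P.value (𝓝[>] (0 : ℝ)) (𝓝 P.value₁) ∧
      ∀ x ∈ P.optimal₁, P.FeasibleLimitingOptimal x) :=
  mainTheorem1_general P hbdd hH₀
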